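/- Let $\mathsf G(z)$ be a $p\times m$ proper real rational transfer function matrix with rows $\mathsf G_1(z),\dots,\mathsf G_p(z)$. The minimal order of a proper transfer function matrix is the least state dimension of a state-space realization of it. Let $n$ be the minimal order of $\mathsf G$, let $l$ be its lag (the observability index of a minimal realization, i.e. the least $k$ such that $\mathrm{col}(C,CA,\dots,CA^{k-1})$ has full column rank), and let $n_i$ be the minimal order of $\mathsf G_i$, with $n_i\ge 1$ for every $i$. Write $\mathsf G_i(z)=\frac{1}{\mathsf D_i(z)}\mathsf N_i(z)$, where $\mathsf D_i$ is a monic polynomial of degree $n_i$ and $\mathsf N_i$ is a $1\times m$ row of polynomials of degree at most $n_i$. Consider a discrete-time system $x(t+1)=Ax(t)+Bu(t)$, $y(t)=Cx(t)+Du(t)$, of any state dimension, that has transfer function matrix $\mathsf G$ and the same input-output trajectories as a minimal realization of $\mathsf G$. Let $N\ge l$ and let $U_{\mathrm p}\in\mathbb R^{mN\times T}$, $U_{\mathrm f}\in\mathbb R^{m\times T}$, $Y_{\mathrm p}\in\mathbb R^{pN\times T}$, $Y_{\mathrm f}\in\mathbb R^{p\times T}$ be data matrices such that, for each column, the stacked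 inputs (from $U_{\mathrm p},U_{\mathrm f}$) and outputs (from $Y_{\mathrm p},Y_{\mathrm f}$) form an input-output trajectory of length $N+1$ of the system, and such that $$\mathrm{rank}\begin{bmatrix}U_{\mathrm p}\\U_{\mathrm f}\\Y_{\mathrm p}\end{bmatrix}=m(N+1)+n .$$ For $i\in\{1,\dots,p\}$ let $Y_{\mathrm p,i}=(I_N\otimes e_i^\top)Y_{\mathrm p}$ and $Y_{\mathrm f,i}=e_i^\top Y_{\mathrm f}$ be the parts of $Y_{\mathrm p}$, $Y_{\mathrm f}$ that belong to the $i$-th output, let $\mathrm H_i=\begin{bmatrix}U_{\mathrm p}\\U_{\mathrm f}\\Y_{\mathrm p,i}\end{bmatrix}$, let $\mathrm H_i^\dagger$ be its Moore–Penrose inverse, and write $$Y_{\mathrm f,i}\mathrm H_i^\dagger=[\,b_{0,i}^\top,\dots,b_{N-1,i}^\top,\,b_{N,i}^\top,\,a_{0,i},\dots,a_{N-1,i}\,],\qquad b_{k,i}\in\mathbb R^m,\ a_{k,i}\in\mathbb R .$$ Then for each $i$ with $n_i\le N$ there is a monic real polynomial $\mathsf C_i^\star(z)$ of degree $N-n_i$,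 all of whose complex roots lie strictly inside the unit disk, such that $$z^N-\sum_{k=0}^{N-1}a_{k,i}z^k=\mathsf C_i^\star(z)\,\mathsf D_i(z),\qquad \sum_{k=0}^{N}b_{k,i}^\top z^k=\mathsf C_i^\star(z)\,\mathsf N_i(z).$$ Moreover, $\mathsf C_i^\star(z)$ is determined solely by $\mathsf G_i(z)$ and $N$; in particular it does not depend on the data. -/

import Mathlib

open scoped Matrix

/-! ### The Moore-Penrose inverse of a real matrix -/

section MoorePenrose

/-- `X` satisfies the four Penrose equations for `A`. -/
structure IsMoorePenrose {r c : Type*} [Fintype r] [Fintype c]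
    (A : Matrix r c ℝ) (X : Matrix c r ℝ) : Prop where
  mul_mul_self : A * X * A = A
  mul_mul_inv : X * A * X = X
  isSymm_left : (A * X)ᵀ = A * X
  isSymm_right : (X * A)ᵀ = X * A

theorem exists_isMoorePenrose {r c : Type*} [Fintype r] [Fintype c]
    (A : Matrix r c ℝ) : ∃ X : Matrix c r ℝ, IsMoorePenrose A X := by
  classical
  obtain ⟨Z, hZt, hMZM, hZMZ, hcomm⟩ : ∃ Z : Matrix c c ℝ, Zᵀ = Z ∧
      (Aᵀ * A) * Z * (Aᵀ * A) = Aᵀ * A ∧ Z * (Aᵀ * A) * Z = Z ∧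
      (Aᵀ * A) * Z = Z * (Aᵀ * A) := by
    have hM : (Aᵀ * A).IsHermitian := by
      have h := Matrix.isHermitian_conjTranspose_mul_self A
      rwa [Matrix.conjTranspose_eq_transpose_of_trivial] at h
    have hspec := hM.spectral_theorem
    rw [Unitary.conjStarAlgAut_apply] at hspec
    set d : c → ℝ := hM.eigenvalues
    set U : Matrix c c ℝ := (hM.eigenvectorUnitary : Matrix c c ℝ)
    have hU : star U * U = 1 := Unitary.coe_star_mul_self hM.eigenvectorUnitary
    have hd : (RCLike.ofReal ∘ d : c → ℝ) = d := by ext; simp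
    rw [hd] at hspec
    have key : ∀ f g : c → ℝ,
        (U * Matrix.diagonal f * star U) * (U * Matrix.diagonal g * star U)
          = U * Matrix.diagonal (fun i => f i * g i) * star U := by
      intro f g
      calc (U * Matrix.diagonal f * star U) * (U * Matrix.diagonal g * star U)
          = U * Matrix.diagonal f * (star U * U) * Matrix.diagonal g * star U := by
            simp only [Matrix.mul_assoc]
        _ = _ := by
            rw [hU, Matrix.mul_one, Matrix.mul_assoc U, Matrix.diagonal_mul_diagonal]
    refine ⟨U * Matrix.diagonal (fun i => (d i)⁻¹) * star U, ?_, ?_, ?_, ?_⟩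
    · rw [Matrix.star_eq_conjTranspose, Matrix.conjTranspose_eq_transpose_of_trivial]
      simp [Matrix.transpose_mul, Matrix.mul_assoc]
    · rw [hspec, key, key]
      congr 3
      ext i
      by_cases h : d i = 0 <;> simp [h]
    · rw [hspec, key, key]
      congr 3
      ext i
      by_cases h : d i = 0 <;> simp [h]
    · rw [hspec, key, key]
      congr 3
      ext i
      ring
  have hAZ : A * Z * (Aᵀ * A) = A := by
    have h0 : (A * Z * (Aᵀ * A) - A)ᵀ * (A * Z * (Aᵀ * A) - A) = 0 := by
      have h1 : (A * Z * (Aᵀ * A) - A)ᵀ = Aᵀ * A * Z * Aᵀ - Aᵀ := by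
        simp [Matrix.transpose_mul, hZt, Matrix.mul_assoc]
      have h2 : Aᵀ * (A * Z * (Aᵀ * A) - A) = 0 := by
        rw [Matrix.mul_sub, sub_eq_zero, ← hMZM]
        simp only [Matrix.mul_assoc] at hMZM ⊢
        rw [hMZM, hMZM]
      rw [h1, Matrix.sub_mul, h2, Matrix.mul_assoc, h2]
      simp
    rw [← Matrix.conjTranspose_eq_transpose_of_trivial] at h0
    exact sub_eq_zero.mp (Matrix.conjTranspose_mul_self_eq_zero.mp h0)
  refine ⟨Z * Aᵀ, ?_, ?_, ?_, ?_⟩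
  · simpa only [Matrix.mul_assoc] using hAZ
  · calc Z * Aᵀ * A * (Z * Aᵀ) = Z * (Aᵀ * A) * Z * Aᵀ := by simp only [Matrix.mul_assoc]
      _ = Z * Aᵀ := by rw [hZMZ]
  · simp [Matrix.transpose_mul, hZt, Matrix.mul_assoc]
  · rw [Matrix.mul_assoc, Matrix.transpose_mul, hZt, Matrix.transpose_mul,
      Matrix.transpose_transpose, hcomm]

theorem IsMoorePenrose.unique {r c : Type*} [Fintype r] [Fintype c]
    {A : Matrix r c ℝ} {X Y : Matrix c r ℝ} (hX : IsMoorePenrose A X)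
    (hY : IsMoorePenrose A Y) : X = Y := by
  have h1 : A * X = A * Y := by
    calc A * X = (A * Y * A) * X := by rw [hY.mul_mul_self]
      _ = (A * Y)ᵀ * (A * X)ᵀ := by
        rw [hY.isSymm_left, hX.isSymm_left]; simp only [Matrix.mul_assoc]
      _ = (A * X * A * Y)ᵀ := by
        rw [← Matrix.transpose_mul]; simp only [Matrix.mul_assoc]
      _ = A * Y := by rw [hX.mul_mul_self, hY.isSymm_left]
  have h2 : X * A = Y * A := by
    calc X * A = X * (A * Y * A) := by rw [hY.mul_mul_self]
      _ = (X * A)ᵀ * (Y * A)ᵀ := by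
        rw [hY.isSymm_right, hX.isSymm_right]; simp only [Matrix.mul_assoc]
      _ = (Y * (A * X * A))ᵀ := by
        rw [← Matrix.transpose_mul]; simp only [Matrix.mul_assoc]
      _ = Y * A := by rw [hX.mul_mul_self, hY.isSymm_right]
  calc X = X * A * X := hX.mul_mul_inv.symm
    _ = Y * (A * X) := by rw [h2, Matrix.mul_assoc]
    _ = Y := by rw [h1, ← Matrix.mul_assoc, hY.mul_mul_inv]

/-- The Moore-Penrose inverse: the unique matrix satisfying the four Penrose equations. -/
noncomputable def moorePenrose {r c : Type*} [Fintype r] [Fintype c]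
    (A : Matrix r c ℝ) : Matrix c r ℝ :=
  (exists_isMoorePenrose A).choose

theorem moorePenrose_spec {r c : Type*} [Fintype r] [Fintype c]
    (A : Matrix r c ℝ) : IsMoorePenrose A (moorePenrose A) :=
  (exists_isMoorePenrose A).choose_spec

end MoorePenrose

/-! ### Discrete-time linear time-invariant systems -/

/-- A state-space system `x(t+1) = A x(t) + B u(t)`, `y(t) = C x(t) + D u(t)` with `n` states,
`m` inputs and `p` outputs. -/
structure StateSpace (n m p : ℕ) where
  A : Matrix (Fin n) (Fin n) ℝ
  B : Matrix (Fin n) (Fin m) ℝ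
  C : Matrix (Fin p) (Fin n) ℝ
  D : Matrix (Fin p) (Fin m) ℝ

namespace StateSpace

variable {n m p : ℕ}

/-- The transfer function matrix `C (zI - A)⁻¹ B + D`, with entries in `ℝ(z)`. -/
noncomputable def transferMatrix (S : StateSpace n m p) :
    Matrix (Fin p) (Fin m) (RatFunc ℝ) :=
  S.C.map (algebraMap ℝ (RatFunc ℝ))
      * (S.A.charmatrix.map (algebraMap (Polynomial ℝ) (RatFunc ℝ)))⁻¹
      * S.B.map (algebraMap ℝ (RatFunc ℝ))
    + S.D.map (algebraMap ℝ (RatFunc ℝ))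

/-- The set of all input-output trajectories `(u, y)` of length `k`. -/
def trajectories (S : StateSpace n m p) (k : ℕ) :
    Set ((Fin k → Fin m → ℝ) × (Fin k → Fin p → ℝ)) :=
  {w | ∃ x : ℕ → Fin n → ℝ, ∀ t : Fin k,
    x ((t : ℕ) + 1) = S.A *ᵥ x t + S.B *ᵥ w.1 t ∧ w.2 t = S.C *ᵥ x t + S.D *ᵥ w.1 t}

/-- The observability matrix `col(C, CA, …, CA^(k-1))`. -/
def observabilityMatrix (S : StateSpace n m p) (k : ℕ) :
    Matrix (Fin k × Fin p) (Fin n) ℝ :=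
  Matrix.of fun r j => (S.C * S.A ^ (r.1 : ℕ)) r.2 j

/-- The observability index: the least `k` such that `col(C, CA, …, CA^(k-1))` has full column
rank. -/
noncomputable def observabilityIndex (S : StateSpace n m p) : ℕ :=
  sInf {k | (S.observabilityMatrix k).rank = n}

end StateSpace

/-- The minimal order of a proper transfer function matrix: the least state dimension of a
state-space realization. -/
noncomputable def minimalOrder {m p : ℕ} (G : Matrix (Fin p) (Fin m) (RatFunc ℝ)) : ℕ :=
  sInf {n | ∃ S : StateSpace n m p, S.transferMatrix = G}

/-- `S` is a minimal realization of `G`. -/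
def StateSpace.IsMinimalRealization {n m p : ℕ} (S : StateSpace n m p)
    (G : Matrix (Fin p) (Fin m) (RatFunc ℝ)) : Prop :=
  S.transferMatrix = G ∧ n = minimalOrder G

/-- The `i`-th row `G_i` of `G`, as a `1 × m` transfer function matrix. -/
def outputRow {m p : ℕ} (G : Matrix (Fin p) (Fin m) (RatFunc ℝ)) (i : Fin p) :
    Matrix (Fin 1) (Fin m) (RatFunc ℝ) :=
  Matrix.of fun _ j => G i j

/-! ### Data matrices

The past matrices are indexed by (time, channel), and the future matrices, for the prediction
horizon one, by the channel. -/

section Data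

variable {m p N T : ℕ}

/-- The matrix `col(U_p, U_f, Y_p)`. The row index type of `Y_p` is left free, so that the same
definition gives the matrix `H` and, with `Y_{p,i}` in place of `Y_p`, the matrix `H_i`. -/
def stackedData {ι : Type*} (Up : Matrix (Fin N × Fin m) (Fin T) ℝ) (Uf : Matrix (Fin m) (Fin T) ℝ)
    (Yp : Matrix ι (Fin T) ℝ) : Matrix ((Fin N × Fin m) ⊕ (Fin m ⊕ ι)) (Fin T) ℝ :=
  Matrix.fromRows Up (Matrix.fromRows Uf Yp)

/-- `Y_{p,i} = (I_N ⊗ e_iᵀ) Y_p`: the rows of `Y_p` that belong to the `i`-th output. -/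
def outputPast (Yp : Matrix (Fin N × Fin p) (Fin T) ℝ) (i : Fin p) : Matrix (Fin N) (Fin T) ℝ :=
  Matrix.of fun k j => Yp (k, i) j

/-- The `j`-th data column as a pair of an input and an output signal of length `N + 1`. -/
def dataTrajectory (Up : Matrix (Fin N × Fin m) (Fin T) ℝ) (Uf : Matrix (Fin m) (Fin T) ℝ)
    (Yp : Matrix (Fin N × Fin p) (Fin T) ℝ) (Yf : Matrix (Fin p) (Fin T) ℝ) (j : Fin T) :
    (Fin (N + 1) → Fin m → ℝ) × (Fin (N + 1) → Fin p → ℝ) :=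
  (Fin.snoc (α := fun _ => Fin m → ℝ) (fun k a => Up (k, a) j) (fun a => Uf a j),
   Fin.snoc (α := fun _ => Fin p → ℝ) (fun k c => Yp (k, c) j) (fun c => Yf c j))

/-- The row vector `Y_{f,i} H_i^†` of the `i`-th output. -/
noncomputable def predictorRow (Up : Matrix (Fin N × Fin m) (Fin T) ℝ)
    (Uf : Matrix (Fin m) (Fin T) ℝ) (Yp : Matrix (Fin N × Fin p) (Fin T) ℝ)
    (Yf : Matrix (Fin p) (Fin T) ℝ) (i : Fin p) : (Fin N × Fin m) ⊕ (Fin m ⊕ Fin N) → ℝ :=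
  Yf i ᵥ* moorePenrose (stackedData Up Uf (outputPast Yp i))

/-- For a row vector `[b_0ᵀ, …, b_{N-1}ᵀ, b_Nᵀ, a_0, …, a_{N-1}]`, the denominator
`z^N - ∑_{k<N} a_k z^k` of the difference equation that it defines. -/
noncomputable def denominatorPoly (h : (Fin N × Fin m) ⊕ (Fin m ⊕ Fin N) → ℝ) : Polynomial ℝ :=
  Polynomial.X ^ N
    - ∑ k : Fin N, Polynomial.C (h (Sum.inr (Sum.inr k))) * Polynomial.X ^ (k : ℕ)

/-- For a row vector `[b_0ᵀ, …, b_{N-1}ᵀ, b_Nᵀ, a_0, …, a_{N-1}]`, the `j`-th entry of the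
numerator `∑_{k≤N} b_kᵀ z^k` of the difference equation that it defines. -/
noncomputable def numeratorPoly (h : (Fin N × Fin m) ⊕ (Fin m ⊕ Fin N) → ℝ) (j : Fin m) :
    Polynomial ℝ :=
  (∑ k : Fin N, Polynomial.C (h (Sum.inl (k, j))) * Polynomial.X ^ (k : ℕ))
    + Polynomial.C (h (Sum.inr (Sum.inl j))) * Polynomial.X ^ N

end Data

/-- A real polynomial is Schur stable if all its complex roots have modulus less than one. -/
def IsSchurStable (P : Polynomial ℝ) : Prop :=
  ∀ z : ℂ, Polynomial.aeval z P = 0 → ‖z‖ < 1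

/-! A row vector indexed like `H_i` is a difference equation `F y_i = E u`, that is, a denominator
`F` of degree `N` and numerators `E`. The claim follows by reading the two properties of `r =
Y_{f,i} H_i^†` as statements on `(F, E)`: `r` solves `r H_i = Y_{f,i}` exactly, and `r` is
orthogonal to the left kernel of `H_i`.

Exactness: a minimal realization is reachable, so `D_i y_i = N_i u` holds along every trajectory,
whatever the initial state (`symbolEval_eq`). Its shift by `N - n_i` expresses `Y_{f,i}` through the
rows of `H_i`, so the pseudoinverse fits without error. By the rank condition initial states and
inputs satisfy no linear relation over the data (`eq_zero_of_forall_data`), so the fit forces `F G_i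
= E`. As `n_i` is minimal, `D_i` divides every common denominator of `G_i` (`IsMonicFraction.dvd`),
whence `F = P D_i` and `E = P N_i`.

Orthogonality: the shifts `z^k (D_i, N_i)` with `k < N - n_i` lie in the left kernel of `H_i`. Hence
`P` is the monic orthogonal polynomial of degree `N - n_i` for the inner product that compares the
coefficients of `P D_i` and `P N_i`. This fixes `P` by `G_i` and `N` alone. Multiplication by `z` is
an isometry for this product, so the classical Szegő argument puts the roots in the open disk: if `P
= (z - α) Q`, then `P ⟂ Q` gives `‖Q‖² = ‖zQ‖² = ‖P‖² + |α|² ‖Q‖²`. -/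

/-! ### Resolvents: polynomial part and strict properness. -/

section Resolvent

open Polynomial

variable {n : ℕ}

/-- The rational function `c (zI - A)⁻¹ b`. -/
noncomputable def resolventEntry (A : Matrix (Fin n) (Fin n) ℝ) (c b : Fin n → ℝ) :
    RatFunc ℝ :=
  (fun k => algebraMap ℝ (RatFunc ℝ) (c k)) ⬝ᵥ
    ((A.charmatrix.map (algebraMap ℝ[X] (RatFunc ℝ)))⁻¹ *ᵥ
      fun k => algebraMap ℝ (RatFunc ℝ) (b k))

theorem algebraMap_C_ratFunc (a : ℝ) :
    algebraMap ℝ[X] (RatFunc ℝ) (C a) = algebraMap ℝ (RatFunc ℝ) a := by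
  rw [← Polynomial.algebraMap_eq, ← IsScalarTower.algebraMap_apply]

theorem StateSpace.transferMatrix_apply {m p : ℕ} (S : StateSpace n m p) (i : Fin p)
    (j : Fin m) :
    S.transferMatrix i j = resolventEntry S.A (S.C i) (fun k => S.B k j)
      + algebraMap ℝ (RatFunc ℝ) (S.D i j) := by
  rw [StateSpace.transferMatrix, Matrix.mul_assoc, Matrix.add_apply]
  rfl

theorem isUnit_det_charmatrix_map (A : Matrix (Fin n) (Fin n) ℝ) :
    IsUnit (A.charmatrix.map (algebraMap ℝ[X] (RatFunc ℝ))).det := by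
  have h : (A.charmatrix.map (algebraMap ℝ[X] (RatFunc ℝ))).det
      = algebraMap ℝ[X] (RatFunc ℝ) A.charpoly := by
    rw [Matrix.charpoly, RingHom.map_det]; rfl
  rw [h, isUnit_iff_ne_zero]
  exact (map_ne_zero_iff _ (IsFractionRing.injective ℝ[X] (RatFunc ℝ))).mpr
    A.charpoly_monic.ne_zero

theorem resolventEntry_add (A : Matrix (Fin n) (Fin n) ℝ) (c c' b : Fin n → ℝ) :
    resolventEntry A (c + c') b = resolventEntry A c b + resolventEntry A c' b := by
  simp only [resolventEntry, ← add_dotProduct]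
  congr 1
  ext k
  simp

theorem resolventEntry_smul (A : Matrix (Fin n) (Fin n) ℝ) (a : ℝ) (c b : Fin n → ℝ) :
    resolventEntry A (a • c) b = algebraMap ℝ (RatFunc ℝ) a * resolventEntry A c b := by
  simp only [resolventEntry, ← smul_eq_mul, ← smul_dotProduct]
  congr 1
  ext k
  simp

theorem resolventEntry_zero (A : Matrix (Fin n) (Fin n) ℝ) (b : Fin n → ℝ) :
    resolventEntry A 0 b = 0 := by
  simpa using resolventEntry_smul A 0 0 b

theorem algebraMap_dotProduct (c b : Fin n → ℝ) :
    algebraMap ℝ (RatFunc ℝ) (c ⬝ᵥ b) = (fun k => algebraMap ℝ (RatFunc ℝ) (c k)) ⬝ᵥ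
      (fun k => algebraMap ℝ (RatFunc ℝ) (b k)) := by
  simp [dotProduct]

theorem charmatrix_map_algebraMap (A : Matrix (Fin n) (Fin n) ℝ) :
    A.charmatrix.map (algebraMap ℝ[X] (RatFunc ℝ))
      = algebraMap ℝ[X] (RatFunc ℝ) X • (1 : Matrix (Fin n) (Fin n) (RatFunc ℝ))
        - A.map (algebraMap ℝ (RatFunc ℝ)) := by
  ext i j : 1
  by_cases h : i = j
  · subst h
    simp only [Matrix.map_apply, Matrix.charmatrix_apply_eq, map_sub, algebraMap_C_ratFunc,
      Matrix.sub_apply, Matrix.smul_apply, Matrix.one_apply_eq, smul_eq_mul, mul_one]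
  · simp only [Matrix.map_apply, Matrix.charmatrix_apply_ne _ _ _ h, map_neg,
      algebraMap_C_ratFunc, Matrix.sub_apply, Matrix.smul_apply, Matrix.one_apply_ne h, smul_zero,
      zero_sub]

/-- A row `w` with `w (zI - A) = c'` satisfies `c' (zI - A)⁻¹ b' = w b'`. -/
theorem dotProduct_inv_mulVec_of_vecMul (A : Matrix (Fin n) (Fin n) ℝ)
    {w c' : Fin n → RatFunc ℝ}
    (h : w ᵥ* A.charmatrix.map (algebraMap ℝ[X] (RatFunc ℝ)) = c') (b' : Fin n → RatFunc ℝ) :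
    c' ⬝ᵥ ((A.charmatrix.map (algebraMap ℝ[X] (RatFunc ℝ)))⁻¹ *ᵥ b') = w ⬝ᵥ b' := by
  rw [← h, ← Matrix.dotProduct_mulVec, Matrix.mulVec_mulVec,
    Matrix.mul_nonsing_inv _ (isUnit_det_charmatrix_map A), Matrix.one_mulVec]

/-- This is `z (zI - A)⁻¹ = I + A (zI - A)⁻¹`; iterating it splits `P(z) c (zI - A)⁻¹ b` into a
resolvent entry with row `c P(A)` and a polynomial. -/
theorem X_mul_resolventEntry (A : Matrix (Fin n) (Fin n) ℝ) (c b : Fin n → ℝ) :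
    algebraMap ℝ[X] (RatFunc ℝ) X * resolventEntry A c b
      = algebraMap ℝ (RatFunc ℝ) (c ⬝ᵥ b) + resolventEntry A (c ᵥ* A) b := by
  set f := algebraMap ℝ (RatFunc ℝ)
  have h := dotProduct_inv_mulVec_of_vecMul A
    (w := fun k => f (c k)) rfl (fun k => f (b k))
  have h2 : (fun k => f ((c ᵥ* A) k)) = (fun k => f (c k)) ᵥ* A.map f := by
    ext k
    simp [Matrix.vecMul, dotProduct]
  rw [charmatrix_map_algebraMap, Matrix.vecMul_sub, sub_dotProduct, Matrix.vecMul_smul,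
    Matrix.vecMul_one, smul_dotProduct, smul_eq_mul, ← charmatrix_map_algebraMap] at h
  rw [algebraMap_dotProduct, ← h, resolventEntry, resolventEntry, h2]
  ring

/-- The polynomial part of `P(z) c (zI - A)⁻¹ b`. -/
noncomputable def resolventPolyPart (A : Matrix (Fin n) (Fin n) ℝ) (c b : Fin n → ℝ) :
    ℝ[X] →ₗ[ℝ] ℝ[X] :=
  Polynomial.lsum fun k => LinearMap.toSpanSingleton ℝ ℝ[X]
    (∑ s ∈ Finset.range k, C (c ⬝ᵥ (A ^ (k - 1 - s) *ᵥ b)) * X ^ s)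

theorem resolventPolyPart_monomial (A : Matrix (Fin n) (Fin n) ℝ) (c b : Fin n → ℝ)
    (k : ℕ) (a : ℝ) : resolventPolyPart A c b (monomial k a)
      = a • ∑ s ∈ Finset.range k, C (c ⬝ᵥ (A ^ (k - 1 - s) *ᵥ b)) * X ^ s := by
  rw [resolventPolyPart, Polynomial.lsum_apply, Polynomial.sum_monomial_index]
  · rfl
  · simp

theorem X_pow_mul_resolventEntry (A : Matrix (Fin n) (Fin n) ℝ) (c b : Fin n → ℝ) (k : ℕ) :
    algebraMap ℝ[X] (RatFunc ℝ) (X ^ k) * resolventEntry A c b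
      = resolventEntry A (c ᵥ* A ^ k) b + algebraMap ℝ[X] (RatFunc ℝ)
        (∑ s ∈ Finset.range k, C (c ⬝ᵥ (A ^ (k - 1 - s) *ᵥ b)) * X ^ s) := by
  induction k with
  | zero => simp
  | succ k ih =>
    rw [pow_succ', map_mul, mul_assoc, ih, mul_add, X_mul_resolventEntry, Matrix.vecMul_vecMul,
      ← pow_succ, Finset.sum_range_succ', map_add, ← Matrix.dotProduct_mulVec,
      add_comm (algebraMap ℝ (RatFunc ℝ) _), add_assoc, ← map_mul, Finset.mul_sum]
    congr 1
    rw [add_comm]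
    congr 1
    · congr 1
      refine Finset.sum_congr rfl fun s _ => ?_
      rw [show k + 1 - 1 - (s + 1) = k - 1 - s by omega]
      ring
    · simp

theorem algebraMap_mul_resolventEntry (A : Matrix (Fin n) (Fin n) ℝ) (c b : Fin n → ℝ)
    (P : ℝ[X]) :
    algebraMap ℝ[X] (RatFunc ℝ) P * resolventEntry A c b
      = resolventEntry A (c ᵥ* aeval A P) b
        + algebraMap ℝ[X] (RatFunc ℝ) (resolventPolyPart A c b P) := by
  induction P using Polynomial.induction_on' with
  | add P Q hP hQ =>
    rw [map_add, add_mul, hP, hQ, map_add, Matrix.vecMul_add, resolventEntry_add, map_add,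
      map_add]
    ring
  | monomial k a =>
    have h : c ᵥ* (algebraMap ℝ (Matrix (Fin n) (Fin n) ℝ) a * A ^ k) = a • (c ᵥ* A ^ k) := by
      rw [← Algebra.smul_def, Matrix.vecMul_smul]
    rw [resolventPolyPart_monomial, aeval_monomial, h, ← C_mul_X_pow_eq_monomial, map_mul, mul_assoc,
      X_pow_mul_resolventEntry, mul_add, algebraMap_C_ratFunc, ← resolventEntry_smul,
      Polynomial.smul_eq_C_mul, map_mul, algebraMap_C_ratFunc]

theorem degree_resolventPolyPart_lt (A : Matrix (Fin n) (Fin n) ℝ) (c b : Fin n → ℝ)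
    (P : ℝ[X]) : (resolventPolyPart A c b P).degree < (P.natDegree : WithBot ℕ) := by
  rw [← Polynomial.mem_degreeLT, resolventPolyPart, Polynomial.lsum_apply, Polynomial.sum]
  refine Submodule.sum_mem _ fun k hk => ?_
  rw [LinearMap.toSpanSingleton_apply]
  refine Submodule.smul_mem _ _ (Submodule.sum_mem _ fun s hs => ?_)
  rw [Polynomial.mem_degreeLT]
  refine (degree_C_mul_X_pow_le _ _).trans_lt ?_
  have := le_natDegree_of_mem_supp k hk
  have := Finset.mem_range.mp hs
  exact_mod_cast (by omega : s < P.natDegree)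

/-- Strict properness: after multiplication by the characteristic polynomial, Cayley-Hamilton leaves
only the polynomial part, whose degree is too small for a nonzero `q`. -/
theorem eq_zero_of_resolventEntry_eq (A : Matrix (Fin n) (Fin n) ℝ) (c b : Fin n → ℝ)
    {q : ℝ[X]} (h : resolventEntry A c b = algebraMap ℝ[X] (RatFunc ℝ) q) : q = 0 := by
  have h1 := algebraMap_mul_resolventEntry A c b A.charpoly
  rw [Matrix.aeval_self_charpoly, Matrix.vecMul_zero, resolventEntry_zero, zero_add, h,
    ← map_mul] at h1
  have h2 := IsFractionRing.injective ℝ[X] (RatFunc ℝ) h1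
  by_contra hq
  have h3 := degree_resolventPolyPart_lt A c b A.charpoly
  rw [← h2, Polynomial.degree_mul, degree_eq_natDegree A.charpoly_monic.ne_zero,
    degree_eq_natDegree hq] at h3
  have : A.charpoly.natDegree + q.natDegree < A.charpoly.natDegree := by exact_mod_cast h3
  omega

/-- Multiplying by `z` equates the resolvent entry of `c A` with the constant `-c b`. By strict
properness both vanish, and the induction continues with `c A` in place of `c`. -/
theorem dotProduct_pow_mulVec_eq_zero (A : Matrix (Fin n) (Fin n) ℝ) (c b : Fin n → ℝ)
    (h : resolventEntry A c b = 0) (s : ℕ) : c ⬝ᵥ (A ^ s *ᵥ b) = 0 := by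
  induction s generalizing c with
  | zero =>
    have h1 := X_mul_resolventEntry A c b
    rw [h, mul_zero, eq_comm, add_comm, add_eq_zero_iff_eq_neg, ← algebraMap_C_ratFunc, ← map_neg]
      at h1
    simpa using eq_zero_of_resolventEntry_eq _ _ _ h1
  | succ s ih =>
    have h1 := X_mul_resolventEntry A c b
    rw [h, mul_zero, eq_comm, add_comm, add_eq_zero_iff_eq_neg, ← algebraMap_C_ratFunc, ← map_neg]
      at h1
    have h2 := eq_zero_of_resolventEntry_eq _ _ _ h1
    rw [h2, map_zero] at h1
    rw [pow_succ', ← Matrix.mulVec_mulVec, Matrix.dotProduct_mulVec]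
    exact ih _ h1

/-! ### Difference operators along state trajectories. -/

/-- The value on a signal `v` of the difference operator with symbol `P`. -/
def symbolEval (v : ℕ → ℝ) : ℝ[X] →ₗ[ℝ] ℝ :=
  Polynomial.lsum fun k => LinearMap.toSpanSingleton ℝ ℝ (v k)

theorem symbolEval_monomial (v : ℕ → ℝ) (k : ℕ) (a : ℝ) :
    symbolEval v (monomial k a) = a * v k := by
  rw [symbolEval, Polynomial.lsum_apply, Polynomial.sum_monomial_index]
  · rfl
  · simp

theorem symbolEval_eq_sum_range (v : ℕ → ℝ) {P : ℝ[X]} {K : ℕ} (h : P.natDegree ≤ K) :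
    symbolEval v P = ∑ k ∈ Finset.range (K + 1), P.coeff k * v k := by
  rw [symbolEval, Polynomial.lsum_apply,
    Polynomial.sum_over_range' _ (by simp) (K + 1) (by omega)]
  rfl

/-- Variation of constants. The input coefficients are exactly those of the polynomial part of `z^k
c (zI - A)⁻¹ B`, which links the time domain to the transfer function. -/
theorem dotProduct_state {m : ℕ} (A : Matrix (Fin n) (Fin n) ℝ) (B : Matrix (Fin n) (Fin m) ℝ)
    {x : ℕ → Fin n → ℝ} {u : ℕ → Fin m → ℝ} (hx : ∀ t, x (t + 1) = A *ᵥ x t + B *ᵥ u t)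
    (c : Fin n → ℝ) (k : ℕ) :
    c ⬝ᵥ x k = (c ᵥ* A ^ k) ⬝ᵥ x 0 + ∑ j, ∑ s ∈ Finset.range k,
      (c ⬝ᵥ (A ^ (k - 1 - s) *ᵥ fun a => B a j)) * u s j := by
  induction k generalizing c with
  | zero => simp
  | succ k ih =>
    rw [hx, dotProduct_add, Matrix.dotProduct_mulVec, ih, Matrix.vecMul_vecMul, ← pow_succ',
      add_assoc]
    congr 1
    rw [Matrix.dotProduct_mulVec c B, dotProduct, ← Finset.sum_add_distrib]
    refine Finset.sum_congr rfl fun j _ => ?_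
    rw [Finset.sum_range_succ]
    congr 1
    · refine Finset.sum_congr rfl fun s hs => ?_
      have := Finset.mem_range.mp hs
      rw [← Matrix.dotProduct_mulVec, Matrix.mulVec_mulVec, ← pow_succ',
        show k + 1 - 1 - s = k - 1 - s + 1 by omega]
    · simp [Matrix.vecMul]

/-- The difference operator with symbol `P`, applied to the output `c x` of a state equation. -/
theorem symbolEval_state {m : ℕ} (A : Matrix (Fin n) (Fin n) ℝ) (B : Matrix (Fin n) (Fin m) ℝ)
    {x : ℕ → Fin n → ℝ} {u : ℕ → Fin m → ℝ} (hx : ∀ t, x (t + 1) = A *ᵥ x t + B *ᵥ u t)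
    (c : Fin n → ℝ) (P : ℝ[X]) :
    symbolEval (fun k => c ⬝ᵥ x k) P = (c ᵥ* aeval A P) ⬝ᵥ x 0
      + ∑ j, symbolEval (fun s => u s j) (resolventPolyPart A c (fun a => B a j) P) := by
  induction P using Polynomial.induction_on' with
  | add P Q hP hQ =>
    simp only [map_add, hP, hQ, Matrix.vecMul_add, add_dotProduct, Finset.sum_add_distrib]
    ring
  | monomial k a =>
    have h (v : ℕ → ℝ) (b : ℝ) (s : ℕ) : symbolEval v (C b * X ^ s) = b * v s := by
      rw [C_mul_X_pow_eq_monomial, symbolEval_monomial]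
    simp only [symbolEval_monomial, resolventPolyPart_monomial, aeval_monomial, map_smul, map_sum,
      h, ← Algebra.smul_def, Matrix.vecMul_smul, smul_dotProduct, ← Finset.smul_sum]
    rw [dotProduct_state A B hx, smul_eq_mul, smul_eq_mul, mul_add]

theorem symbolEval_add_signal (v w : ℕ → ℝ) (P : ℝ[X]) :
    symbolEval (fun k => v k + w k) P = symbolEval v P + symbolEval w P := by
  simp only [symbolEval_eq_sum_range _ le_rfl, mul_add, Finset.sum_add_distrib]

theorem symbolEval_dotProduct {m : ℕ} (u : ℕ → Fin m → ℝ) (d : Fin m → ℝ) (P : ℝ[X]) :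
    symbolEval (fun k => d ⬝ᵥ u k) P = ∑ j, d j * symbolEval (fun k => u k j) P := by
  simp only [symbolEval_eq_sum_range _ le_rfl, dotProduct, Finset.mul_sum]
  rw [Finset.sum_comm]
  refine Finset.sum_congr rfl fun j _ => Finset.sum_congr rfl fun k _ => ?_
  ring

end Resolvent

/-! ### Orthogonal polynomials for a shift-invariant inner product. -/

section Orthogonality

open Polynomial

variable {ι : Type*} [Fintype ι]

/-- `P` is orthogonal to `X ^ k` for `k < natDegree P`, for the coefficient inner product
of the products with the weights `F i`, truncated at degree `K`. -/
def IsWeightedOrthogonal (F : ι → ℝ[X]) (K : ℕ) (P : ℝ[X]) : Prop :=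
  ∀ k < P.natDegree,
    ∑ i, ∑ l ∈ Finset.range (K + 1), (P * F i).coeff l * (X ^ k * F i).coeff l = 0

theorem IsWeightedOrthogonal.sum_coeff_mul_eq_zero {F : ι → ℝ[X]} {K : ℕ} {P : ℝ[X]}
    (hP : IsWeightedOrthogonal F K P) {E : ℝ[X]} (hE : E.degree < (P.natDegree : WithBot ℕ)) :
    ∑ i, ∑ l ∈ Finset.range (K + 1), (P * F i).coeff l * (E * F i).coeff l = 0 := by
  have hE2 : E = ∑ k ∈ Finset.range P.natDegree, C (E.coeff k) * X ^ k := by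
    by_cases h0 : E = 0
    · simp [h0]
    · exact E.as_sum_range_C_mul_X_pow' ((natDegree_lt_iff_degree_lt h0).mpr hE)
  have key (i : ι) (l : ℕ) : (P * F i).coeff l * (E * F i).coeff l
      = ∑ k ∈ Finset.range P.natDegree,
        E.coeff k * ((P * F i).coeff l * (X ^ k * F i).coeff l) := by
    conv_lhs => rw [hE2]
    rw [Finset.sum_mul, Polynomial.finsetSum_coeff, Finset.mul_sum]
    refine Finset.sum_congr rfl fun k _ => ?_
    rw [mul_assoc, coeff_C_mul]
    ring
  simp only [key]
  rw [Finset.sum_congr rfl fun i _ => Finset.sum_comm, Finset.sum_comm]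
  refine Finset.sum_eq_zero fun k hk => ?_
  simp only [← Finset.mul_sum]
  rw [hP k (Finset.mem_range.mp hk), mul_zero]

/-- Both polynomials are orthogonal to their difference, which has lower degree, so the difference
has norm zero. The degree bounds ensure that the truncation at `K` loses nothing. -/
theorem IsWeightedOrthogonal.unique {F : ι → ℝ[X]} {K : ℕ} {P Q : ℝ[X]}
    (hP : IsWeightedOrthogonal F K P) (hQ : IsWeightedOrthogonal F K Q)
    (hPm : P.Monic) (hQm : Q.Monic) (hd : P.natDegree = Q.natDegree) {i : ι} (hi : F i ≠ 0)
    (hPK : (P * F i).natDegree ≤ K) (hQK : (Q * F i).natDegree ≤ K) : P = Q := by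
  have hlt : (P - Q).degree < (P.natDegree : WithBot ℕ) := by
    rw [← degree_eq_natDegree hPm.ne_zero]
    exact degree_sub_lt_left (by rw [degree_eq_natDegree hPm.ne_zero, degree_eq_natDegree hQm.ne_zero,
      hd]) hPm.ne_zero (by rw [hPm.leadingCoeff, hQm.leadingCoeff])
  have h1 := hP.sum_coeff_mul_eq_zero hlt
  have h2 := hQ.sum_coeff_mul_eq_zero (hd ▸ hlt)
  have h3 : ∑ i, ∑ l ∈ Finset.range (K + 1), ((P - Q) * F i).coeff l ^ 2 = 0 := by
    rw [← sub_eq_zero.mpr (h1.trans h2.symm), ← Finset.sum_sub_distrib]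
    refine Finset.sum_congr rfl fun i _ => ?_
    rw [← Finset.sum_sub_distrib]
    refine Finset.sum_congr rfl fun l _ => ?_
    rw [sub_mul, coeff_sub]
    ring
  rw [Finset.sum_eq_zero_iff_of_nonneg fun i _ => Finset.sum_nonneg fun l _ => sq_nonneg _] at h3
  have h4 := h3 i (Finset.mem_univ i)
  rw [Finset.sum_eq_zero_iff_of_nonneg fun l _ => sq_nonneg _] at h4
  have h5 : (P - Q) * F i = 0 := by
    ext l
    by_cases hl : l < K + 1
    · simpa using h4 l (Finset.mem_range.mpr hl)
    · rw [coeff_zero]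
      refine coeff_eq_zero_of_natDegree_lt ?_
      rw [sub_mul]
      exact (natDegree_sub_le _ _).trans_lt (by omega)
  exact sub_eq_zero.mp ((mul_eq_zero.mp h5).resolve_right hi)

/-- Weighted orthogonal polynomials have all their roots in the open unit disk. -/
theorem IsWeightedOrthogonal.isSchurStable {F : ι → ℝ[X]} {K : ℕ} {P : ℝ[X]}
    (hP : IsWeightedOrthogonal F K P) (hP0 : P ≠ 0) (hK : ∀ i, (P * F i).natDegree ≤ K)
    {i₀ : ι} (hi₀ : F i₀ ≠ 0) : IsSchurStable P := by
  intro α hα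
  set f := algebraMap ℝ ℂ
  have hroot : (P.map f).IsRoot α := by
    rw [IsRoot.def, eval_map_algebraMap, hα]
  obtain ⟨Q, hQ⟩ := dvd_iff_isRoot.mpr hroot
  have hPm0 : P.map f ≠ 0 := (Polynomial.map_ne_zero_iff f.injective).mpr hP0
  have hQ0 : Q ≠ 0 := by rintro rfl; simp [hPm0] at hQ
  have hdeg : P.natDegree = Q.natDegree + 1 := by
    rw [← natDegree_map_eq_of_injective f.injective P, hQ, natDegree_mul (X_sub_C_ne_zero α) hQ0,
      natDegree_X_sub_C, add_comm]
  set G : ι → ℂ[X] := fun i => (F i).map f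
  -- Since `Q` has one degree less than `P`, the top slot `K` is free, and multiplication by `X`
  -- preserves the truncated norm of `Q`.
  have hQG (i : ι) : (Q * G i).coeff K = 0 := by
    by_cases hF : F i = 0
    · simp [G, hF]
    · refine coeff_eq_zero_of_natDegree_lt ?_
      have h1 := hK i
      rw [natDegree_mul hP0 hF, hdeg] at h1
      have h2 : (Q * G i).natDegree ≤ Q.natDegree + (G i).natDegree := natDegree_mul_le
      have h3 : (G i).natDegree ≤ (F i).natDegree := natDegree_map_le
      omega
  have horthk (k : ℕ) (hk : k < P.natDegree) :
      ∑ i, ∑ l ∈ Finset.range (K + 1), (P.map f * G i).coeff l * (X ^ k * G i).coeff l = 0 := by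
    have h := congrArg f (hP k hk)
    simp only [map_sum, map_mul, map_zero] at h
    rw [← h]
    refine Finset.sum_congr rfl fun i _ => Finset.sum_congr rfl fun l _ => ?_
    rw [← Polynomial.map_mul, coeff_map, show (X : ℂ[X]) ^ k = (X ^ k : ℝ[X]).map f by simp,
      ← Polynomial.map_mul, coeff_map]
  have hreal (i : ι) (k l : ℕ) : star ((X ^ k * G i).coeff l) = (X ^ k * G i).coeff l := by
    rw [show (X : ℂ[X]) ^ k = (X ^ k : ℝ[X]).map f by simp, ← Polynomial.map_mul, coeff_map]
    exact Complex.conj_ofReal _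
  -- The weights are real, so conjugation only affects the coefficients of `Q`, and orthogonality to
  -- monomials extends to the complex `Q`.
  have horth : ∑ i, ∑ l ∈ Finset.range (K + 1),
      (P.map f * G i).coeff l * star ((Q * G i).coeff l) = 0 := by
    have key (i : ι) (l : ℕ) : (P.map f * G i).coeff l * star ((Q * G i).coeff l)
        = ∑ k ∈ Finset.range P.natDegree,
          star (Q.coeff k) * ((P.map f * G i).coeff l * (X ^ k * G i).coeff l) := by
      conv_lhs => rw [Q.as_sum_range_C_mul_X_pow]
      rw [Finset.sum_mul, Polynomial.finsetSum_coeff, star_sum, Finset.mul_sum, hdeg]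
      refine Finset.sum_congr rfl fun k _ => ?_
      rw [mul_assoc (C _), coeff_C_mul, star_mul', hreal]
      ring
    simp only [key]
    rw [Finset.sum_congr rfl fun i _ => Finset.sum_comm, Finset.sum_comm]
    refine Finset.sum_eq_zero fun k hk => ?_
    simp only [← Finset.mul_sum]
    rw [horthk k (Finset.mem_range.mp hk), mul_zero]
  have hshift (i : ι) : ∑ l ∈ Finset.range (K + 1), Complex.normSq ((X * (Q * G i)).coeff l)
      = ∑ l ∈ Finset.range (K + 1), Complex.normSq ((Q * G i).coeff l) := by
    rw [Finset.sum_range_succ', Finset.sum_range_succ]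
    simp [hQG]
  have hexp (i : ι) (l : ℕ) : Complex.normSq ((X * (Q * G i)).coeff l)
      = Complex.normSq ((P.map f * G i).coeff l)
        + Complex.normSq α * Complex.normSq ((Q * G i).coeff l)
        + 2 * (star α * ((P.map f * G i).coeff l * star ((Q * G i).coeff l))).re := by
    have h1 : X * (Q * G i) = P.map f * G i + C α * (Q * G i) := by rw [hQ]; ring
    rw [h1, coeff_add, coeff_C_mul, Complex.normSq_add, Complex.normSq_mul]
    congr 3
    rw [map_mul]
    simp only [starRingEnd_apply]
    ring
  -- Pythagoras for `X Q = P + α Q`, the cross term being zero by `horth`.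
  have hsum : ∑ i, ∑ l ∈ Finset.range (K + 1), Complex.normSq ((Q * G i).coeff l)
      = ∑ i, ∑ l ∈ Finset.range (K + 1), Complex.normSq ((P.map f * G i).coeff l)
        + Complex.normSq α *
          ∑ i, ∑ l ∈ Finset.range (K + 1), Complex.normSq ((Q * G i).coeff l) := by
    conv_lhs => simp only [← hshift, hexp]
    simp only [Finset.sum_add_distrib, ← Finset.mul_sum, ← Complex.re_sum]
    rw [horth]
    simp
  have hpos : 0 < ∑ i, ∑ l ∈ Finset.range (K + 1),
      Complex.normSq ((P.map f * G i).coeff l) := by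
    refine Finset.sum_pos' (fun i _ => Finset.sum_nonneg fun l _ => Complex.normSq_nonneg _)
      ⟨i₀, Finset.mem_univ _, ?_⟩
    refine Finset.sum_pos' (fun l _ => Complex.normSq_nonneg _)
      ⟨(P * F i₀).natDegree, Finset.mem_range.mpr (Nat.lt_succ_of_le (hK i₀)), ?_⟩
    rw [Complex.normSq_pos, ← Polynomial.map_mul, coeff_map, coeff_natDegree]
    exact (map_ne_zero f).mpr (leadingCoeff_ne_zero.mpr (mul_ne_zero hP0 hi₀))
  have hnn : 0 ≤ ∑ i, ∑ l ∈ Finset.range (K + 1), Complex.normSq ((Q * G i).coeff l) :=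
    Finset.sum_nonneg fun i _ => Finset.sum_nonneg fun l _ => Complex.normSq_nonneg _
  have hα2 : Complex.normSq α < 1 := by
    by_contra! h
    nlinarith
  rw [Complex.normSq_eq_norm_sq] at hα2
  nlinarith [norm_nonneg α]

end Orthogonality

/-! ### Minimal realizations and reachability. -/

section Realization

open Polynomial

variable {m p : ℕ}

theorem minimalOrder_le_of_transferMatrix_eq {n : ℕ} {G : Matrix (Fin p) (Fin m) (RatFunc ℝ)}
    (S : StateSpace n m p) (h : S.transferMatrix = G) : minimalOrder G ≤ n :=
  Nat.sInf_le ⟨S, h⟩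

/-- Change of coordinates to an invariant subspace parametrized by `T`. -/
theorem resolventEntry_of_intertwine {n w : ℕ} {A : Matrix (Fin n) (Fin n) ℝ}
    {A' : Matrix (Fin w) (Fin w) ℝ} {T : Matrix (Fin n) (Fin w) ℝ} (h : A * T = T * A')
    (c : Fin n → ℝ) (b : Fin w → ℝ) :
    resolventEntry A' (c ᵥ* T) b = resolventEntry A c (T *ᵥ b) := by
  set f := algebraMap ℝ (RatFunc ℝ)
  set M := A.charmatrix.map (algebraMap ℝ[X] (RatFunc ℝ)) with hM
  have hT : (M * T.map f) = T.map f * A'.charmatrix.map (algebraMap ℝ[X] (RatFunc ℝ)) := by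
    rw [hM, charmatrix_map_algebraMap, charmatrix_map_algebraMap, Matrix.sub_mul, Matrix.mul_sub,
      ← Matrix.map_mul, ← Matrix.map_mul, h, Matrix.smul_mul, Matrix.mul_smul, Matrix.one_mul,
      Matrix.mul_one]
  have h1 : (((fun k => f (c k)) ᵥ* M⁻¹) ᵥ* T.map f) ᵥ*
      A'.charmatrix.map (algebraMap ℝ[X] (RatFunc ℝ)) = fun k => f ((c ᵥ* T) k) := by
    rw [Matrix.vecMul_vecMul, ← hT, ← Matrix.vecMul_vecMul, Matrix.vecMul_vecMul _ _ M,
      Matrix.nonsing_inv_mul _ (isUnit_det_charmatrix_map A), Matrix.vecMul_one]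
    ext k
    simp [Matrix.vecMul, dotProduct]
  have h2 : (fun k => f ((T *ᵥ b) k)) = T.map f *ᵥ fun k => f (b k) := by
    ext k
    simp [Matrix.mulVec, dotProduct]
  rw [resolventEntry, dotProduct_inv_mulVec_of_vecMul A' h1, resolventEntry, h2,
    Matrix.dotProduct_mulVec, Matrix.dotProduct_mulVec]

/-- A minimal realization is reachable: no nonzero row annihilates all `A ^ s B`. -/
theorem StateSpace.IsMinimalRealization.eq_zero_of_dotProduct {n : ℕ}
    {G : Matrix (Fin p) (Fin m) (RatFunc ℝ)} {R : StateSpace n m p}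
    (hR : R.IsMinimalRealization G) {c : Fin n → ℝ}
    (hc : ∀ (s : ℕ) (j : Fin m), c ⬝ᵥ (R.A ^ s *ᵥ fun a => R.B a j) = 0) : c = 0 := by
  -- `W` is the reachable subspace. In a basis of `W` the system restricts to a realization of `G`
  -- with `dim W` states, so minimality makes `W` the whole space, on which `c` vanishes.
  set W : Submodule ℝ (Fin n → ℝ) :=
    Submodule.span ℝ (Set.range fun q : ℕ × Fin m => R.A ^ q.1 *ᵥ fun a => R.B a q.2)
  have hcW : ∀ v ∈ W, c ⬝ᵥ v = 0 := by
    intro v hv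
    induction hv using Submodule.span_induction with
    | mem v hv => obtain ⟨q, rfl⟩ := hv; exact hc q.1 q.2
    | zero => simp
    | add v w _ _ hv hw => rw [dotProduct_add, hv, hw, add_zero]
    | smul a v _ hv => rw [dotProduct_smul, hv, smul_zero]
  have hAW : ∀ v ∈ W, R.A *ᵥ v ∈ W := by
    intro v hv
    induction hv using Submodule.span_induction with
    | mem v hv =>
      obtain ⟨q, rfl⟩ := hv
      refine Submodule.subset_span ⟨(q.1 + 1, q.2), ?_⟩
      simp only [Matrix.mulVec_mulVec, pow_succ']
    | zero => simp
    | add v w _ _ hv hw => rw [Matrix.mulVec_add]; exact W.add_mem hv hw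
    | smul a v _ hv => rw [Matrix.mulVec_smul]; exact W.smul_mem a hv
  have hBW (j : Fin m) : (fun a => R.B a j) ∈ W :=
    Submodule.subset_span ⟨(0, j), by simp⟩
  let e := Module.finBasis ℝ W
  let T : Matrix (Fin n) (Fin (Module.finrank ℝ W)) ℝ := Matrix.of fun a k => (e k : Fin n → ℝ) a
  have hT : ∀ v ∈ W, ∃ y, v = T *ᵥ y := by
    intro v hv
    refine ⟨e.repr ⟨v, hv⟩, ?_⟩
    have h := congrArg Subtype.val (e.sum_repr ⟨v, hv⟩)
    ext a
    have h' := congrFun h a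
    simp only [Submodule.coe_sum, Submodule.coe_smul, Finset.sum_apply, Pi.smul_apply,
      smul_eq_mul] at h'
    rw [← h', Matrix.mulVec, dotProduct]
    exact Finset.sum_congr rfl fun k _ => mul_comm _ _
  choose A' hA' using fun k => hT _ (hAW _ (e k).2)
  choose B' hB' using fun j => hT _ (hBW j)
  have hAT : R.A * T = T * (Matrix.of fun i k => A' k i) := by
    ext a k
    exact congrFun (hA' k) a
  have htf : (StateSpace.mk (Matrix.of fun i k => A' k i) (Matrix.of fun i j => B' j i)
      (R.C * T) R.D).transferMatrix = G := by
    rw [← hR.1]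
    ext i j : 2
    rw [StateSpace.transferMatrix_apply, StateSpace.transferMatrix_apply]
    congr 1
    rw [hB' j]
    exact resolventEntry_of_intertwine hAT (R.C i) (B' j)
  have hle := minimalOrder_le_of_transferMatrix_eq _ htf
  rw [← hR.2] at hle
  have hW : W = ⊤ := by
    apply Submodule.eq_top_of_finrank_eq
    exact le_antisymm (Submodule.finrank_le W) (by simpa using hle)
  exact dotProduct_eq_zero c fun v => hcW v (hW ▸ Submodule.mem_top)

/-! ### Observer form and fractions of minimal degree. -/

/-- The observer canonical form of a monic fraction `Q / P`. -/
noncomputable def observerForm (d : ℕ) (P : ℝ[X]) (Q : Fin m → ℝ[X]) : StateSpace d m 1 where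
  A := Matrix.of fun i k => if (k : ℕ) + 1 = d then -P.coeff i else if (i : ℕ) = k + 1 then 1 else 0
  B := Matrix.of fun k j => (Q j).coeff k - P.coeff k * (Q j).coeff d
  C := Matrix.of fun _ k => if (k : ℕ) + 1 = d then 1 else 0
  D := Matrix.of fun _ j => (Q j).coeff d

/-- The row `(1, z, …, z^(d-1))` is shifted by the companion matrix, with `z^d` reduced modulo `P`.
Hence this row times `zI - A` is `P` times the output row, which yields the transfer function. -/
theorem observerForm_vecMul_A {d : ℕ} {P : ℝ[X]} (hP : P.Monic) (hd : P.natDegree = d)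
    (Q : Fin m → ℝ[X]) (k : Fin d) :
    ∑ i : Fin d, X ^ (i : ℕ) * C ((observerForm d P Q).A i k)
      = X ^ ((k : ℕ) + 1) - P * C ((observerForm d P Q).C 0 k) := by
  have hP' := hP.as_sum
  rw [hd, ← Fin.sum_univ_eq_sum_range (fun i => C (P.coeff i) * X ^ i)] at hP'
  by_cases hk : (k : ℕ) + 1 = d
  · simp only [observerForm, Matrix.of_apply, hk, if_true, map_neg, mul_neg,
      Finset.sum_neg_distrib, map_one, mul_one]
    rw [eq_sub_iff_add_eq]
    nth_rewrite 2 [hP']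
    rw [add_left_comm, ← sub_eq_neg_add, sub_eq_zero.mpr, add_zero]
    exact Finset.sum_congr rfl fun i _ => mul_comm _ _
  · simp only [observerForm, Matrix.of_apply, hk, if_false, map_zero, mul_zero, sub_zero]
    rw [Finset.sum_eq_single ⟨k + 1, by omega⟩]
    · simp
    · intro i _ hi
      rw [if_neg fun h => hi (Fin.ext h)]
      simp
    · simp

theorem observerForm_transferMatrix {d : ℕ} {P : ℝ[X]} (hP : P.Monic) (hd : P.natDegree = d)
    {Q : Fin m → ℝ[X]} (hQ : ∀ j, (Q j).natDegree ≤ d) (j : Fin m) :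
    (observerForm d P Q).transferMatrix 0 j
      = algebraMap ℝ[X] (RatFunc ℝ) (Q j) / algebraMap ℝ[X] (RatFunc ℝ) P := by
  set g := algebraMap ℝ[X] (RatFunc ℝ)
  set f := algebraMap ℝ (RatFunc ℝ)
  have hgC (a : ℝ) : g (C a) = f a := algebraMap_C_ratFunc a
  have hP0 : g P ≠ 0 :=
    (map_ne_zero_iff _ (IsFractionRing.injective ℝ[X] (RatFunc ℝ))).mpr hP.ne_zero
  set S := observerForm d P Q with hS
  have hv : (fun k : Fin d => g (X ^ (k : ℕ))) ᵥ* S.A.charmatrix.map g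
      = g P • fun k => f (S.C 0 k) := by
    rw [charmatrix_map_algebraMap, Matrix.vecMul_sub, Matrix.vecMul_smul, Matrix.vecMul_one]
    ext k
    have h := congrArg g (observerForm_vecMul_A hP hd Q k)
    simp only [map_sum, map_mul, map_sub, hgC] at h
    simp only [Pi.sub_apply, Pi.smul_apply, smul_eq_mul, Matrix.vecMul, dotProduct,
      Matrix.map_apply]
    change g X * g (X ^ (k : ℕ)) - ∑ i : Fin d, g (X ^ (i : ℕ)) * f (S.A i k) = _
    rw [h, ← map_mul, ← pow_succ']
    ring
  have hres : g P * resolventEntry S.A (S.C 0) (fun k => S.B k j)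
      = g (Q j) - g P * f (S.D 0 j) := by
    have h1 := dotProduct_inv_mulVec_of_vecMul S.A hv (fun k => f (S.B k j))
    rw [smul_dotProduct, smul_eq_mul] at h1
    rw [resolventEntry, h1]
    have hP' := hP.as_sum
    rw [hd, ← Fin.sum_univ_eq_sum_range (fun i => C (P.coeff i) * X ^ i)] at hP'
    have hQ' := (Q j).as_sum_range_C_mul_X_pow' (Nat.lt_succ_of_le (hQ j))
    rw [Finset.sum_range_succ, ← Fin.sum_univ_eq_sum_range (fun i => C ((Q j).coeff i) * X ^ i)]
      at hQ'
    have h2 : ∑ k : Fin d, (X : ℝ[X]) ^ (k : ℕ) * C (S.B k j)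
        = ∑ k : Fin d, C ((Q j).coeff k) * X ^ (k : ℕ)
          - (∑ k : Fin d, C (P.coeff k) * X ^ (k : ℕ)) * C ((Q j).coeff d) := by
      rw [Finset.sum_mul, ← Finset.sum_sub_distrib]
      refine Finset.sum_congr rfl fun k _ => ?_
      simp only [hS, observerForm, Matrix.of_apply, map_sub, map_mul]
      ring
    have h4 : ∑ k : Fin d, (X : ℝ[X]) ^ (k : ℕ) * C (S.B k j) = Q j - P * C (S.D 0 j) := by
      change _ = Q j - P * C ((Q j).coeff d)
      linear_combination h2 - hQ' + C ((Q j).coeff d) * hP'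
    have h3 := congrArg g h4
    simp only [map_sum, map_mul, map_sub, hgC] at h3
    exact h3
  rw [StateSpace.transferMatrix_apply, eq_div_iff hP0, mul_comm, mul_add]
  change g P * resolventEntry S.A (S.C 0) (fun k => S.B k j) + g P * f (S.D 0 j) = _
  rw [hres]
  ring

theorem minimalOrder_le_natDegree {g : Matrix (Fin 1) (Fin m) (RatFunc ℝ)} {P : ℝ[X]}
    (hP : P.Monic) {Q : Fin m → ℝ[X]} (hQ : ∀ j, (Q j).natDegree ≤ P.natDegree)
    (hg : ∀ j, g 0 j = algebraMap ℝ[X] (RatFunc ℝ) (Q j) / algebraMap ℝ[X] (RatFunc ℝ) P) :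
    minimalOrder g ≤ P.natDegree := by
  refine minimalOrder_le_of_transferMatrix_eq (observerForm P.natDegree P Q) ?_
  ext i j : 2
  rw [Subsingleton.elim i 0, observerForm_transferMatrix hP rfl hQ, hg]

/-- `g = N / D` with `D` monic of degree the minimal order of `g` and `N / D` proper. -/
structure IsMonicFraction (g : Matrix (Fin 1) (Fin m) (RatFunc ℝ)) (D : ℝ[X])
    (N : Fin m → ℝ[X]) : Prop where
  monic : D.Monic
  natDegree_eq : D.natDegree = minimalOrder g
  natDegree_le : ∀ j, (N j).natDegree ≤ minimalOrder g
  eq_div : ∀ j, g 0 j = algebraMap ℝ[X] (RatFunc ℝ) (N j) / algebraMap ℝ[X] (RatFunc ℝ) D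

namespace IsMonicFraction

variable {g : Matrix (Fin 1) (Fin m) (RatFunc ℝ)} {D : ℝ[X]} {N : Fin m → ℝ[X]}

theorem mul_eq (h : IsMonicFraction g D N) (j : Fin m) :
    algebraMap ℝ[X] (RatFunc ℝ) D * g 0 j = algebraMap ℝ[X] (RatFunc ℝ) (N j) := by
  rw [h.eq_div, mul_div_cancel₀]
  exact (map_ne_zero_iff _ (IsFractionRing.injective ℝ[X] (RatFunc ℝ))).mpr h.monic.ne_zero

/-- Every common denominator of the entries of `g` is a multiple of `D`. -/
theorem dvd (h : IsMonicFraction g D N) {P : ℝ[X]} {Q : Fin m → ℝ[X]}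
    (hPQ : ∀ j, algebraMap ℝ[X] (RatFunc ℝ) P * g 0 j = algebraMap ℝ[X] (RatFunc ℝ) (Q j)) :
    D ∣ P := by
  have hinj := IsFractionRing.injective ℝ[X] (RatFunc ℝ)
  rw [← modByMonic_eq_zero_iff_dvd h.monic]
  by_contra hr
  -- The remainder is again a common denominator of `g`. If nonzero and made monic, it would give an
  -- observer form with fewer than `minimalOrder g` states.
  set r := P %ₘ D
  have hr' : algebraMap ℝ[X] (RatFunc ℝ) r ≠ 0 := (map_ne_zero_iff _ hinj).mpr hr
  have hrP : r = P - D * (P /ₘ D) := eq_sub_of_add_eq (modByMonic_add_div P D)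
  have hlt : r.natDegree < D.natDegree :=
    natDegree_lt_natDegree hr (degree_modByMonic_lt P h.monic)
  have hlc : r.leadingCoeff⁻¹ ≠ 0 := inv_ne_zero (leadingCoeff_ne_zero.mpr hr)
  set q : Fin m → ℝ[X] := fun j => Q j - N j * (P /ₘ D)
  have hq (j : Fin m) :
      algebraMap ℝ[X] (RatFunc ℝ) r * g 0 j = algebraMap ℝ[X] (RatFunc ℝ) (q j) := by
    simp only [hrP, q, map_sub, map_mul, sub_mul, hPQ, ← h.mul_eq j]
    ring
  -- The observer form needs a proper fraction: `r N = q D` and `deg N ≤ deg D` give `deg q ≤ deg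
  -- r`.
  have hqd (j : Fin m) : (q j).natDegree ≤ r.natDegree := by
    by_cases hq0 : q j = 0
    · simp [hq0]
    · have h1 : r * N j = q j * D := by
        apply hinj
        rw [map_mul, map_mul, ← hq, ← h.mul_eq]
        ring
      have hN0 : N j ≠ 0 := by
        intro h0
        rw [h0, mul_zero, eq_comm] at h1
        exact (mul_ne_zero hq0 h.monic.ne_zero) h1
      have h2 := congrArg natDegree h1
      rw [natDegree_mul hr hN0, natDegree_mul hq0 h.monic.ne_zero, h.natDegree_eq] at h2
      have := h.natDegree_le j
      omega
  have hmon : (C r.leadingCoeff⁻¹ * r).Monic := by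
    rw [mul_comm]; exact monic_mul_leadingCoeff_inv hr
  have hdeg : (C r.leadingCoeff⁻¹ * r).natDegree = r.natDegree := natDegree_C_mul hlc
  have hle := minimalOrder_le_natDegree (g := g) hmon
    (Q := fun j => C r.leadingCoeff⁻¹ * q j)
    (fun j => by rw [hdeg, natDegree_C_mul hlc]; exact hqd j)
    (fun j => by
      have hc : algebraMap ℝ[X] (RatFunc ℝ) (C r.leadingCoeff⁻¹) ≠ 0 :=
        (map_ne_zero_iff _ hinj).mpr (C_ne_zero.mpr hlc)
      rw [map_mul, map_mul, mul_div_mul_left _ _ hc, ← hq, mul_div_cancel_left₀ _ hr'])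
  rw [hdeg, ← h.natDegree_eq] at hle
  omega

theorem unique (h : IsMonicFraction g D N) {D' : ℝ[X]} {N' : Fin m → ℝ[X]}
    (h' : IsMonicFraction g D' N') : D = D' ∧ N = N' := by
  have hD : D = D' := (eq_of_monic_of_dvd_of_natDegree_le h.monic h'.monic
    (h.dvd h'.mul_eq) (by rw [h.natDegree_eq, h'.natDegree_eq])).symm
  refine ⟨hD, funext fun j => IsFractionRing.injective ℝ[X] (RatFunc ℝ) ?_⟩
  rw [← h.mul_eq, ← h'.mul_eq, hD]

end IsMonicFraction

end Realization

/-! ### From data to difference equations. -/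

section Predictor

open Polynomial

/-- `X = X Xᵀ Aᵀ` shows that `y X` is a combination of the columns of `A`, all of which `e`
annihilates. -/
theorem IsMoorePenrose.vecMul_dotProduct_eq_zero {r c : Type*} [Fintype r] [Fintype c]
    {A : Matrix r c ℝ} {X : Matrix c r ℝ} (h : IsMoorePenrose A X) {e : r → ℝ}
    (he : e ᵥ* A = 0) (y : c → ℝ) : (y ᵥ* X) ⬝ᵥ e = 0 := by
  have hX : X = X * Xᵀ * Aᵀ := by
    rw [Matrix.mul_assoc, ← Matrix.transpose_mul, h.isSymm_left, ← Matrix.mul_assoc, h.mul_mul_inv]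
  rw [hX, ← Matrix.vecMul_vecMul, ← Matrix.dotProduct_mulVec, Matrix.mulVec_transpose, he,
    dotProduct_zero]

theorem IsMoorePenrose.vecMul_vecMul_eq {r c : Type*} [Fintype r] [Fintype c]
    {A : Matrix r c ℝ} {X : Matrix c r ℝ} (h : IsMoorePenrose A X) {e : r → ℝ} {y : c → ℝ}
    (he : e ᵥ* A = y) : (y ᵥ* X) ᵥ* A = y := by
  rw [← he, Matrix.vecMul_vecMul, Matrix.vecMul_vecMul, ← Matrix.mul_assoc, h.mul_mul_self]

variable {m p n : ℕ}

/-- Padding the input by zero and rerunning the recursion from `x 0` makes the state equation hold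
at all times, without changing the first `K` samples. -/
theorem StateSpace.exists_state_of_mem_trajectories (S : StateSpace n m p) {K : ℕ}
    {w : (Fin K → Fin m → ℝ) × (Fin K → Fin p → ℝ)} (hw : w ∈ S.trajectories K) :
    ∃ (x : ℕ → Fin n → ℝ) (u : ℕ → Fin m → ℝ), (∀ t, x (t + 1) = S.A *ᵥ x t + S.B *ᵥ u t) ∧
      ∀ t : Fin K, w.1 t = u t ∧ ∀ c, w.2 t c = S.C c ⬝ᵥ x t + S.D c ⬝ᵥ u t := by
  obtain ⟨x, hx⟩ := hw
  let u : ℕ → Fin m → ℝ := fun t => if h : t < K then w.1 ⟨t, h⟩ else 0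
  have hu (t : Fin K) : u t = w.1 t := by simp [u]
  let z : ℕ → Fin n → ℝ := fun t => Nat.rec (x 0) (fun t v => S.A *ᵥ v + S.B *ᵥ u t) t
  have hz (t : ℕ) (ht : t ≤ K) : z t = x t := by
    induction t with
    | zero => rfl
    | succ t ih =>
      change S.A *ᵥ z t + S.B *ᵥ u t = _
      rw [ih (by omega), (hx ⟨t, by omega⟩).1, ← hu ⟨t, by omega⟩]
  refine ⟨z, u, fun t => rfl, fun t => ⟨(hu t).symm, fun c => ?_⟩⟩
  rw [hz t t.2.le, hu, (hx t).2]
  rfl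

theorem symbolEval_output {A : Matrix (Fin n) (Fin n) ℝ} {B : Matrix (Fin n) (Fin m) ℝ}
    {x : ℕ → Fin n → ℝ} {u : ℕ → Fin m → ℝ} (hx : ∀ t, x (t + 1) = A *ᵥ x t + B *ᵥ u t)
    (c : Fin n → ℝ) (d : Fin m → ℝ) (P : ℝ[X]) :
    symbolEval (fun k => c ⬝ᵥ x k + d ⬝ᵥ u k) P = (c ᵥ* aeval A P) ⬝ᵥ x 0
      + ∑ j, symbolEval (fun s => u s j)
        (resolventPolyPart A c (fun a => B a j) P + C (d j) * P) := by
  rw [symbolEval_add_signal, symbolEval_state A B hx, symbolEval_dotProduct, add_assoc,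
    ← Finset.sum_add_distrib]
  congr 1
  refine Finset.sum_congr rfl fun j _ => ?_
  rw [map_add, ← smul_eq_C_mul, map_smul, smul_eq_mul]

/-- The difference equations that a minimal realization satisfies. -/
theorem StateSpace.IsMinimalRealization.symbolEval_eq {G : Matrix (Fin p) (Fin m) (RatFunc ℝ)}
    {R : StateSpace n m p} (hR : R.IsMinimalRealization G) {i : Fin p} {P : ℝ[X]}
    {Q : Fin m → ℝ[X]}
    (hPQ : ∀ j, algebraMap ℝ[X] (RatFunc ℝ) P * G i j = algebraMap ℝ[X] (RatFunc ℝ) (Q j))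
    {x : ℕ → Fin n → ℝ} {u : ℕ → Fin m → ℝ} (hx : ∀ t, x (t + 1) = R.A *ᵥ x t + R.B *ᵥ u t) :
    symbolEval (fun k => R.C i ⬝ᵥ x k + R.D i ⬝ᵥ u k) P
      = ∑ j, symbolEval (fun s => u s j) (Q j) := by
  -- `P G_i = Q` equates a strictly proper function with a polynomial, so both are zero.
  have key (j : Fin m) : resolventEntry R.A (R.C i ᵥ* aeval R.A P) (fun a => R.B a j) = 0 ∧
      resolventPolyPart R.A (R.C i) (fun a => R.B a j) P + Polynomial.C (R.D i j) * P = Q j := by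
    have h := hPQ j
    rw [← hR.1, StateSpace.transferMatrix_apply, mul_add, algebraMap_mul_resolventEntry,
      ← algebraMap_C_ratFunc, ← map_mul, mul_comm P, add_assoc, ← map_add, ← eq_sub_iff_add_eq,
      ← map_sub] at h
    have h0 := eq_zero_of_resolventEntry_eq _ _ _ h
    exact ⟨by rw [h, h0, map_zero], (sub_eq_zero.mp h0).symm⟩
  -- Reachability removes the initial state from the difference equation.
  have hc : R.C i ᵥ* aeval R.A P = 0 :=
    hR.eq_zero_of_dotProduct fun s j => dotProduct_pow_mulVec_eq_zero _ _ _ (key j).1 s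
  rw [symbolEval_output hx, hc, zero_dotProduct, zero_add]
  exact Finset.sum_congr rfl fun j _ => by rw [(key j).2]

variable {N T : ℕ}

/-- Initial states and inputs behind data of full rank satisfy no linear relation. -/
theorem eq_zero_of_forall_data (A : Matrix (Fin n) (Fin n) ℝ) (B : Matrix (Fin n) (Fin m) ℝ)
    (Cm : Matrix (Fin p) (Fin n) ℝ) (Dm : Matrix (Fin p) (Fin m) ℝ)
    {x : Fin T → ℕ → Fin n → ℝ} {u : Fin T → ℕ → Fin m → ℝ}
    (hx : ∀ j t, x j (t + 1) = A *ᵥ x j t + B *ᵥ u j t)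
    {Up : Matrix (Fin N × Fin m) (Fin T) ℝ} {Uf : Matrix (Fin m) (Fin T) ℝ}
    {Yp : Matrix (Fin N × Fin p) (Fin T) ℝ}
    (hUp : ∀ k a j, Up (k, a) j = u j k a) (hUf : ∀ a j, Uf a j = u j N a)
    (hYp : ∀ (k : Fin N) c j, Yp (k, c) j = Cm c ⬝ᵥ x j k + Dm c ⬝ᵥ u j k)
    (hrank : (stackedData Up Uf Yp).rank = m * (N + 1) + n)
    (v : Fin n → ℝ) (q : Fin (N + 1) × Fin m → ℝ)
    (h : ∀ j, v ⬝ᵥ x j 0 + ∑ r, q r * u j r.1 r.2 = 0) : v = 0 ∧ q = 0 := by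
  -- All data rows are combinations of the `n + m (N + 1)` rows of `M`, so the rank condition makes
  -- the rows of `M` independent.
  set M : Matrix (Fin n ⊕ Fin (N + 1) × Fin m) (Fin T) ℝ :=
    Matrix.of fun r j => Sum.elim (fun a => x j 0 a) (fun s => u j s.1 s.2) r with hM
  set W := Submodule.span ℝ (Set.range M.row)
  have hcomb {κ : Type} [Fintype κ] (f : κ → ℝ) (z : Fin T → κ → ℝ)
      (hz : ∀ b, (fun j => z j b) ∈ W) : (fun j => f ⬝ᵥ z j) ∈ W := by
    have : (fun j => f ⬝ᵥ z j) = ∑ b, f b • fun j => z j b := by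
      ext j
      simp [dotProduct]
    rw [this]
    exact Submodule.sum_mem _ fun b _ => Submodule.smul_mem _ _ (hz b)
  have hu (k : ℕ) (hk : k ≤ N) (a : Fin m) : (fun j => u j k a) ∈ W :=
    Submodule.subset_span ⟨Sum.inr (⟨k, by omega⟩, a), rfl⟩
  have hxk (k : ℕ) (hk : k ≤ N) : ∀ a : Fin n, (fun j => x j k a) ∈ W := by
    induction k with
    | zero => exact fun a => Submodule.subset_span ⟨Sum.inl a, rfl⟩
    | succ k ih =>
      intro a
      have : (fun j => x j (k + 1) a) = (fun j => A a ⬝ᵥ x j k) + fun j => B a ⬝ᵥ u j k := by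
        ext j
        rw [hx]
        rfl
      rw [this]
      exact W.add_mem (hcomb _ _ (ih (by omega))) (hcomb _ _ (hu k (by omega)))
  have hle : (stackedData Up Uf Yp).rank ≤ M.rank := by
    rw [Matrix.rank_eq_finrank_span_row, Matrix.rank_eq_finrank_span_row]
    refine Submodule.finrank_mono (Submodule.span_le.mpr ?_)
    rintro _ ⟨(⟨k, a⟩ | a | ⟨k, c⟩), rfl⟩
    · have : (stackedData Up Uf Yp).row (Sum.inl (k, a)) = fun j => u j k a :=
        funext fun j => hUp k a j
      rw [this]
      exact hu k k.2.le a
    · have : (stackedData Up Uf Yp).row (Sum.inr (Sum.inl a)) = fun j => u j N a :=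
        funext fun j => hUf a j
      rw [this]
      exact hu N le_rfl a
    · have : (stackedData Up Uf Yp).row (Sum.inr (Sum.inr (k, c)))
          = (fun j => Cm c ⬝ᵥ x j k) + fun j => Dm c ⬝ᵥ u j k :=
        funext fun j => hYp k c j
      rw [this]
      exact W.add_mem (hcomb _ _ (hxk k k.2.le)) (hcomb _ _ (hu k k.2.le))
  have hli : LinearIndependent ℝ M.row := by
    rw [linearIndependent_iff_card_le_finrank_span, Set.finrank,
      ← Matrix.rank_eq_finrank_span_row]
    refine le_trans (le_of_eq ?_) hle
    rw [hrank]
    simp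
    ring
  have h0 : Sum.elim v q = 0 := by
    apply Matrix.vecMul_injective_iff.mpr hli
    ext j
    simpa [Matrix.vecMul, dotProduct, hM] using h j
  exact ⟨funext fun a => congrFun h0 (Sum.inl a), funext fun a => congrFun h0 (Sum.inr a)⟩

/-! ### Row vectors as pairs of polynomials. -/

/-- The row vector `[b_0ᵀ, …, b_Nᵀ, a_0, …, a_{N-1}]` of the difference equation `P y = Q u`. -/
noncomputable def predictorVec (N : ℕ) (P : ℝ[X]) (Q : Fin m → ℝ[X]) :
    (Fin N × Fin m) ⊕ (Fin m ⊕ Fin N) → ℝ :=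
  Sum.elim (fun r => (Q r.2).coeff r.1)
    (Sum.elim (fun a => (Q a).coeff N) (fun k => -P.coeff k))

theorem coeff_sum_fin (f : Fin N → ℝ) (l : ℕ) :
    (∑ k : Fin N, C (f k) * X ^ (k : ℕ)).coeff l = if h : l < N then f ⟨l, h⟩ else 0 := by
  simp only [finsetSum_coeff, coeff_C_mul_X_pow]
  split_ifs with h
  · rw [Finset.sum_eq_single ⟨l, h⟩]
    · simp
    · intro k _ hk
      exact if_neg fun h' => hk (Fin.ext h'.symm)
    · simp
  · exact Finset.sum_eq_zero fun k _ => if_neg (by omega)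

theorem denominatorPoly_monic (h : (Fin N × Fin m) ⊕ (Fin m ⊕ Fin N) → ℝ) :
    (denominatorPoly h).Monic :=
  monic_X_pow_sub (degree_sum_fin_lt _)

theorem natDegree_denominatorPoly (h : (Fin N × Fin m) ⊕ (Fin m ⊕ Fin N) → ℝ) :
    (denominatorPoly h).natDegree = N := by
  refine natDegree_eq_of_degree_eq_some ?_
  rw [denominatorPoly, degree_sub_eq_left_of_degree_lt, degree_X_pow]
  rw [degree_X_pow]
  exact degree_sum_fin_lt _

theorem natDegree_numeratorPoly_le (h : (Fin N × Fin m) ⊕ (Fin m ⊕ Fin N) → ℝ) (j : Fin m) :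
    (numeratorPoly h j).natDegree ≤ N := by
  refine natDegree_le_of_degree_le ((degree_add_le _ _).trans (max_le ?_ ?_))
  · exact (degree_sum_fin_lt fun k => h (Sum.inl (k, j))).le
  · exact degree_C_mul_X_pow_le _ _

theorem predictorVec_denominatorPoly (h : (Fin N × Fin m) ⊕ (Fin m ⊕ Fin N) → ℝ) :
    predictorVec N (denominatorPoly h) (numeratorPoly h) = h := by
  have hnum (j : Fin m) (l : ℕ) : (numeratorPoly h j).coeff l
      = (if h' : l < N then h (Sum.inl (⟨l, h'⟩, j)) else 0)
        + if l = N then h (Sum.inr (Sum.inl j)) else 0 := by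
    rw [numeratorPoly, coeff_add, coeff_sum_fin fun k => h (Sum.inl (k, j)), coeff_C_mul_X_pow]
  ext (⟨k, a⟩ | a | k)
  · simp [predictorVec, hnum, k.2.ne]
  · simp [predictorVec, hnum]
  · have : (denominatorPoly h).coeff k = -h (Sum.inr (Sum.inr k)) := by
      rw [denominatorPoly, coeff_sub, coeff_sum_fin fun k => h (Sum.inr (Sum.inr k)), coeff_X_pow,
        if_neg k.2.ne, dif_pos k.2, zero_sub]
    simp [predictorVec, this]

/-- `H_i` has no row for the output at time `N`, hence the correction term. For a valid difference
equation the product is `P.coeff N * y N`: the future output if `P` is monic of degree `N`, and zero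
if the degree is lower. -/
theorem predictorVec_vecMul {Up : Matrix (Fin N × Fin m) (Fin T) ℝ}
    {Uf : Matrix (Fin m) (Fin T) ℝ} {Yi : Matrix (Fin N) (Fin T) ℝ} {P : ℝ[X]}
    {Q : Fin m → ℝ[X]} (hP : P.natDegree ≤ N) (hQ : ∀ a, (Q a).natDegree ≤ N) {j : Fin T}
    {u : ℕ → Fin m → ℝ} {y : ℕ → ℝ} (hUp : ∀ k a, Up (k, a) j = u k a)
    (hUf : ∀ a, Uf a j = u N a) (hY : ∀ k, Yi k j = y k) :
    (predictorVec N P Q ᵥ* stackedData Up Uf Yi) j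
      = ∑ a, symbolEval (fun s => u s a) (Q a) - symbolEval y P + P.coeff N * y N := by
  have h1 (a : Fin m) : symbolEval (fun s => u s a) (Q a)
      = ∑ k : Fin N, (Q a).coeff k * u k a + (Q a).coeff N * u N a := by
    rw [symbolEval_eq_sum_range _ (hQ a), Finset.sum_range_succ,
      ← Fin.sum_univ_eq_sum_range (fun k => (Q a).coeff k * u k a)]
  have h2 : symbolEval y P = ∑ k : Fin N, P.coeff k * y k + P.coeff N * y N := by
    rw [symbolEval_eq_sum_range _ hP, Finset.sum_range_succ,
      ← Fin.sum_univ_eq_sum_range (fun k => P.coeff k * y k)]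
  have h3 : ∑ r : Fin N × Fin m, (Q r.2).coeff r.1 * u r.1 r.2
      = ∑ a, ∑ k : Fin N, (Q a).coeff k * u k a := by
    rw [Fintype.sum_prod_type, Finset.sum_comm]
  simp only [h1, h2, Finset.sum_add_distrib, ← h3]
  simp only [Matrix.vecMul, dotProduct, Fintype.sum_sum_type, predictorVec, stackedData,
    Matrix.fromRows_apply_inl, Matrix.fromRows_apply_inr, Sum.elim_inl, Sum.elim_inr, hUp, hUf, hY,
    neg_mul, Finset.sum_neg_distrib]
  ring

/-- The denominator and the numerators of a fraction as one family. -/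
noncomputable def fractionWeights (D : ℝ[X]) (Q : Fin m → ℝ[X]) : Option (Fin m) → ℝ[X] :=
  fun o => o.elim D Q

/-- The missing entry for the coefficient of degree `N` does no harm, since that of `P'` vanishes;
the two signs cancel. -/
theorem predictorVec_dotProduct {P P' : ℝ[X]} {Q Q' : Fin m → ℝ[X]} (h : P'.coeff N = 0) :
    predictorVec N P Q ⬝ᵥ predictorVec N P' Q'
      = ∑ o, ∑ l ∈ Finset.range (N + 1),
        (fractionWeights P Q o).coeff l * (fractionWeights P' Q' o).coeff l := by
  have h1 (F F' : ℝ[X]) : ∑ l ∈ Finset.range (N + 1), F.coeff l * F'.coeff l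
      = ∑ k : Fin N, F.coeff k * F'.coeff k + F.coeff N * F'.coeff N := by
    rw [Finset.sum_range_succ, ← Fin.sum_univ_eq_sum_range (fun k => F.coeff k * F'.coeff k)]
  have h3 : ∑ r : Fin N × Fin m, (Q r.2).coeff r.1 * (Q' r.2).coeff r.1
      = ∑ a, ∑ k : Fin N, (Q a).coeff k * (Q' a).coeff k := by
    rw [Fintype.sum_prod_type, Finset.sum_comm]
  simp only [h1, Fintype.sum_option, fractionWeights, Option.elim_none, Option.elim_some, h,
    Finset.sum_add_distrib, ← h3]
  simp only [dotProduct, Fintype.sum_sum_type, predictorVec, Sum.elim_inl, Sum.elim_inr, neg_mul_neg]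
  ring

/-! ### The stable factor and its identification from data. -/

/-- The stable factor of order `N` of a row `g`: the cofactor of the monic fraction of `g` that is
orthogonal to all polynomials of lower degree. -/
structure IsStableFactor (g : Matrix (Fin 1) (Fin m) (RatFunc ℝ)) (N : ℕ) (P : ℝ[X]) : Prop where
  monic : P.Monic
  natDegree_eq : P.natDegree = N - minimalOrder g
  orthogonal : ∃ D Q, IsMonicFraction g D Q ∧ IsWeightedOrthogonal (fractionWeights D Q) N P

namespace IsStableFactor

variable {g : Matrix (Fin 1) (Fin m) (RatFunc ℝ)} {P : ℝ[X]}

theorem natDegree_mul_fractionWeights_le (h : IsStableFactor g N P) (hN : minimalOrder g ≤ N)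
    {D : ℝ[X]} {Q : Fin m → ℝ[X]} (hDQ : IsMonicFraction g D Q) (o : Option (Fin m)) :
    (P * fractionWeights D Q o).natDegree ≤ N := by
  refine natDegree_mul_le.trans ?_
  have h1 := h.natDegree_eq
  rcases o with _ | a
  · have := hDQ.natDegree_eq
    simp only [fractionWeights, Option.elim_none]
    omega
  · have := hDQ.natDegree_le a
    simp only [fractionWeights, Option.elim_some]
    omega

theorem unique (h : IsStableFactor g N P) {P' : ℝ[X]} (h' : IsStableFactor g N P')
    (hN : minimalOrder g ≤ N) : P = P' := by
  obtain ⟨D, Q, hDQ, ho⟩ := h.orthogonal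
  obtain ⟨D', Q', hDQ', ho'⟩ := h'.orthogonal
  obtain ⟨rfl, rfl⟩ := hDQ.unique hDQ'
  -- The index `none` selects the weight `D`, which is nonzero because it is monic.
  exact ho.unique ho' h.monic h'.monic (h.natDegree_eq.trans h'.natDegree_eq.symm)
    (i := none) hDQ.monic.ne_zero (h.natDegree_mul_fractionWeights_le hN hDQ _)
    (h'.natDegree_mul_fractionWeights_le hN hDQ _)

theorem isSchurStable (h : IsStableFactor g N P) (hN : minimalOrder g ≤ N) :
    IsSchurStable P := by
  obtain ⟨D, Q, hDQ, ho⟩ := h.orthogonal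
  exact ho.isSchurStable h.monic.ne_zero (h.natDegree_mul_fractionWeights_le hN hDQ)
    (i₀ := none) hDQ.monic.ne_zero

end IsStableFactor

theorem predictorRow_eq_stableFactor_mul {G : Matrix (Fin p) (Fin m) (RatFunc ℝ)}
    {R : StateSpace n m p} (hR : R.IsMinimalRealization G)
    {Up : Matrix (Fin N × Fin m) (Fin T) ℝ} {Uf : Matrix (Fin m) (Fin T) ℝ}
    {Yp : Matrix (Fin N × Fin p) (Fin T) ℝ} {Yf : Matrix (Fin p) (Fin T) ℝ}
    (hdata : ∀ j, dataTrajectory Up Uf Yp Yf j ∈ R.trajectories (N + 1))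
    (hrank : (stackedData Up Uf Yp).rank = m * (N + 1) + n)
    {i : Fin p} (hN : minimalOrder (outputRow G i) ≤ N) {D : ℝ[X]} {Q : Fin m → ℝ[X]}
    (hDQ : IsMonicFraction (outputRow G i) D Q) :
    ∃ P, IsStableFactor (outputRow G i) N P ∧
      denominatorPoly (predictorRow Up Uf Yp Yf i) = P * D ∧
      ∀ j, numeratorPoly (predictorRow Up Uf Yp Yf i) j = P * Q j := by
  choose x u hx hxu using fun j => R.exists_state_of_mem_trajectories (hdata j)
  have hUp (k : Fin N) (a : Fin m) (j : Fin T) : Up (k, a) j = u j k a := by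
    have h := congrFun (hxu j k.castSucc).1 a
    simpa [dataTrajectory] using h
  have hUf (a : Fin m) (j : Fin T) : Uf a j = u j N a := by
    have h := congrFun (hxu j (Fin.last N)).1 a
    simpa [dataTrajectory] using h
  have hYp (k : Fin N) (c : Fin p) (j : Fin T) :
      Yp (k, c) j = R.C c ⬝ᵥ x j k + R.D c ⬝ᵥ u j k := by
    have h := (hxu j k.castSucc).2 c
    simpa [dataTrajectory] using h
  have hYf (c : Fin p) (j : Fin T) : Yf c j = R.C c ⬝ᵥ x j N + R.D c ⬝ᵥ u j N := by
    have h := (hxu j (Fin.last N)).2 c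
    simpa [dataTrajectory] using h
  set H := stackedData Up Uf (outputPast Yp i) with hH
  set r := predictorRow Up Uf Yp Yf i with hr
  set n₀ := minimalOrder (outputRow G i) with hn₀
  have hmp := moorePenrose_spec H
  have hvec (F : ℝ[X]) (E : Fin m → ℝ[X]) (hF : F.natDegree ≤ N) (hE : ∀ a, (E a).natDegree ≤ N)
      (j : Fin T) : (predictorVec N F E ᵥ* H) j = ∑ a, symbolEval (fun s => u j s a) (E a)
        - symbolEval (fun k => R.C i ⬝ᵥ x j k + R.D i ⬝ᵥ u j k) F + F.coeff N * Yf i j := by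
    rw [hYf, hH]
    exact predictorVec_vecMul hF hE (y := fun k => R.C i ⬝ᵥ x j k + R.D i ⬝ᵥ u j k)
      (fun k a => hUp k a j) (fun a => hUf a j) (fun k => hYp k i j)
  -- Shifts with `k < N - n₀` give left kernel vectors of `H`; the last one, `k = N - n₀`,
  -- reproduces `Yf i`.
  have hpow (k : ℕ) (hk : k ≤ N - n₀) (j : Fin T) :
      (predictorVec N (X ^ k * D) (fun a => X ^ k * Q a) ᵥ* H) j
        = (X ^ k * D).coeff N * Yf i j := by
    rw [hvec, hR.symbolEval_eq (Q := fun a => X ^ k * Q a) _ (hx j), sub_self, zero_add]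
    · intro a
      rw [map_mul, map_mul, mul_assoc, ← hDQ.mul_eq a]
      rfl
    · refine natDegree_mul_le.trans ?_
      rw [natDegree_X_pow, hDQ.natDegree_eq]
      omega
    · intro a
      refine natDegree_mul_le.trans ?_
      rw [natDegree_X_pow]
      have := hDQ.natDegree_le a
      omega
  have hcoeff (k : ℕ) : (X ^ k * D).natDegree = k + n₀ := by
    rw [(monic_X_pow k).natDegree_mul hDQ.monic, natDegree_X_pow, hDQ.natDegree_eq]
  have hrH : r ᵥ* H = Yf i := by
    refine hmp.vecMul_vecMul_eq
      (e := predictorVec N (X ^ (N - n₀) * D) (fun a => X ^ (N - n₀) * Q a)) ?_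
    ext j
    have hm : ((X ^ (N - n₀) * D).Monic) := (monic_X_pow _).mul hDQ.monic
    have h1 := hm.coeff_natDegree
    rw [hcoeff, Nat.sub_add_cancel hN] at h1
    rw [hpow _ le_rfl, h1, one_mul]
  have hPd := natDegree_denominatorPoly r
  have hPm := denominatorPoly_monic r
  have hQd := natDegree_numeratorPoly_le r
  set F := denominatorPoly r with hF
  set E := numeratorPoly r with hE
  have hFE : predictorVec N F E = r := predictorVec_denominatorPoly r
  have hGE (a : Fin m) : algebraMap ℝ[X] (RatFunc ℝ) F * outputRow G i 0 a
      = algebraMap ℝ[X] (RatFunc ℝ) (E a) := by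
    -- `Z` collects the input coefficients of the residual of `F y = E u`. The exact fit `hrH` is
    -- then a linear relation between initial states and inputs, so `Z` and `C_i F(A)` both vanish.
    set Z : Fin m → ℝ[X] := fun a =>
      resolventPolyPart R.A (R.C i) (fun b => R.B b a) F + C (R.D i a) * F - E a with hZ
    have hZd (a : Fin m) : (Z a).natDegree ≤ N := by
      refine (natDegree_sub_le_of_le (natDegree_add_le_of_degree_le ?_ ?_) (hQd a)).trans
        (max_self N).le
      · refine natDegree_le_of_degree_le ((degree_resolventPolyPart_lt _ _ _ _).le.trans ?_)
        rw [hPd]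
      · exact (natDegree_C_mul_le _ _).trans hPd.le
    have h0 := eq_zero_of_forall_data R.A R.B R.C R.D hx hUp hUf hYp hrank
      (R.C i ᵥ* aeval R.A F) (fun s => (Z s.2).coeff s.1) (fun j => by
        have h1 := hvec F E hPd.le hQd j
        have h2 : F.coeff N = 1 := by rw [← hPd]; exact hPm.coeff_natDegree
        rw [hFE, hrH, h2, one_mul, symbolEval_output (hx j)] at h1
        have h3 : ∑ s : Fin (N + 1) × Fin m, (Z s.2).coeff s.1 * u j s.1 s.2
            = ∑ a, symbolEval (fun k => u j k a) (Z a) := by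
          rw [Fintype.sum_prod_type, Finset.sum_comm]
          refine Finset.sum_congr rfl fun a _ => ?_
          rw [symbolEval_eq_sum_range _ (hZd a),
            ← Fin.sum_univ_eq_sum_range (fun k => (Z a).coeff k * u j k a)]
        rw [h3]
        simp only [hZ, map_sub, Finset.sum_sub_distrib]
        linarith)
    have hZ0 : Z a = 0 := by
      ext l
      by_cases hl : l < N + 1
      · simpa using congrFun h0.2 (⟨l, hl⟩, a)
      · rw [coeff_zero]
        exact coeff_eq_zero_of_natDegree_lt ((hZd a).trans_lt (by omega))
    change _ * G i a = _
    rw [← hR.1, StateSpace.transferMatrix_apply, mul_add, algebraMap_mul_resolventEntry, h0.1,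
      resolventEntry_zero, zero_add, ← algebraMap_C_ratFunc, ← map_mul, mul_comm F, ← map_add,
      sub_eq_zero.mp hZ0]
  obtain ⟨P, hP⟩ := hDQ.dvd hGE
  rw [mul_comm] at hP
  have hEP (a : Fin m) : E a = P * Q a := by
    apply IsFractionRing.injective ℝ[X] (RatFunc ℝ)
    rw [← hGE, hP, map_mul, map_mul, mul_assoc, hDQ.mul_eq]
  have hPmonic : P.Monic := hDQ.monic.of_mul_monic_right (hP ▸ hPm)
  have hPdeg : P.natDegree = N - n₀ := by
    have h := hPd
    rw [hP, hPmonic.natDegree_mul hDQ.monic, hDQ.natDegree_eq] at h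
    omega
  refine ⟨P, ⟨hPmonic, hPdeg, D, Q, hDQ, fun k hk => ?_⟩, hP, hEP⟩
  rw [hPdeg] at hk
  have hc0 : (X ^ k * D).coeff N = 0 :=
    coeff_eq_zero_of_natDegree_lt (by rw [hcoeff]; omega)
  -- Orthogonality of `r` to the kernel vector from `z^k (D, Q)` is the weighted orthogonality of
  -- `P` to `z^k`.
  have h := hmp.vecMul_dotProduct_eq_zero
    (e := predictorVec N (X ^ k * D) (fun a => X ^ k * Q a))
    (by ext j; rw [hpow k hk.le, hc0, zero_mul]; rfl) (Yf i)
  change r ⬝ᵥ _ = 0 at h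
  rw [← hFE, predictorVec_dotProduct hc0, hP, funext hEP] at h
  rw [← h]
  refine Finset.sum_congr rfl fun o _ => ?_
  cases o <;> rfl

end Predictor

theorem theorem1 (m : ℕ) :
    ∃ Cstar : Matrix (Fin 1) (Fin m) (RatFunc ℝ) → ℕ → Polynomial ℝ,
      ∀ (p : ℕ) (G : Matrix (Fin p) (Fin m) (RatFunc ℝ))
        -- every output channel is dynamic
        (_ : ∀ i : Fin p, 1 ≤ minimalOrder (outputRow G i))
        -- a minimal realization of `G`, which determines the order and the lag
        (n : ℕ) (R : StateSpace n m p) (_ : R.IsMinimalRealization G)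
        -- a state-space representation, possibly with more states, of the same system
        (n' : ℕ) (S : StateSpace n' m p) (_ : S.transferMatrix = G)
        (_ : ∀ k : ℕ, S.trajectories k = R.trajectories k)
        -- data matrices whose columns are trajectories of the system
        (N T : ℕ) (Up : Matrix (Fin N × Fin m) (Fin T) ℝ) (Uf : Matrix (Fin m) (Fin T) ℝ)
        (Yp : Matrix (Fin N × Fin p) (Fin T) ℝ) (Yf : Matrix (Fin p) (Fin T) ℝ)
        (_ : ∀ j : Fin T, dataTrajectory Up Uf Yp Yf j ∈ S.trajectories (N + 1))
        -- the rank condition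
        (_ : (stackedData Up Uf Yp).rank = m * (N + 1) + n) (_ : R.observabilityIndex ≤ N)
        -- an output whose order does not exceed `N`, and its monic fraction `G_i = N_i / D_i`
        (i : Fin p) (_ : minimalOrder (outputRow G i) ≤ N)
        (Di : Polynomial ℝ) (Ni : Fin m → Polynomial ℝ)
        (_ : Di.Monic) (_ : Di.natDegree = minimalOrder (outputRow G i))
        (_ : ∀ j : Fin m, (Ni j).natDegree ≤ minimalOrder (outputRow G i))
        (_ : ∀ j : Fin m, G i j = algebraMap (Polynomial ℝ) (RatFunc ℝ) (Ni j)
          / algebraMap (Polynomial ℝ) (RatFunc ℝ) Di),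
        (Cstar (outputRow G i) N).Monic ∧
        (Cstar (outputRow G i) N).natDegree = N - minimalOrder (outputRow G i) ∧
        IsSchurStable (Cstar (outputRow G i) N) ∧
        denominatorPoly (predictorRow Up Uf Yp Yf i) = Cstar (outputRow G i) N * Di ∧
        ∀ j : Fin m,
          numeratorPoly (predictorRow Up Uf Yp Yf i) j = Cstar (outputRow G i) N * Ni j := by
  -- The choice depends on `g` and `N` only; uniqueness of the stable factor identifies it with the
  -- cofactor found from any data.
  refine ⟨fun g N => Classical.epsilon (IsStableFactor g N), ?_⟩
  intro p G _ n R hR n' S _ hSR N T Up Uf Yp Yf hdata hrank _ i hN Di Ni hm hd hNi hG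
  obtain ⟨P, hP, hden, hnum⟩ := predictorRow_eq_stableFactor_mul hR
    (fun j => hSR (N + 1) ▸ hdata j) hrank hN ⟨hm, hd, hNi, hG⟩
  have he : Classical.epsilon (IsStableFactor (outputRow G i) N) = P :=
    (Classical.epsilon_spec ⟨P, hP⟩ : IsStableFactor (outputRow G i) N _).unique hP hN
  simp only [he]
  exact ⟨hP.monic, hP.natDegree_eq, hP.isSchurStable hN, hden, hnum⟩
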